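/- Let $P$ be the set of positive integers ordered by reverse divisibility ($m \le n$ in $P$ if and only if $n \mid m$), regarded as a category with a unique morphism $m \to n$ whenever $m \le n$. Let $X$ be the set of filters on $P$ (nonempty, downward directed, upward closed subsets), ordered by inclusion. Then $X$ is isomorphic to the poset $\mathbb{S}$ of supernatural numbers (formal products $\prod_q q^{e_q}$ over all primes $q$, with $e_q \in \{0,1,2,\dots,\infty\}$) under divisibility, by an order isomorphism that sends the principal filter $\{m : m \mid n\}$ of $n \in P$ to $n = \prod_q q^{v_q(n)}$. The subtoposes of the presheaf topos $\mathsf{PSh}(P)$ are the sheaf toposes $\mathsf{Sh}(P,J)$ for the Grothendieck topologies $J$ on $P$. Let - $\mathbf{x}$ be the cardinality of $X$; - $\mathbf{cl}$ be the cardinality of the set of closed subtoposes of $\mathsf{PSh}(P)$, i.e. of the $J$ such that for some subterminal presheaf $U$ the $J$-sheaves are exactly the presheaves $F$ for which the projection $F \times U \to U$ is an isomorphism; - $\mathbf{coh}$ be the cardinality of the set of coherent subtoposes of $\mathsf{PSh}(P)$, i.e. of the $J$ such that $\mathsf{PSh}(P)$ and $\mathsf{Sh}(P,J)$ are coherent toposes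 and the sheafification functor $\mathsf{PSh}(P) \to \mathsf{Sh}(P,J)$ preserves coherent objects; - $\mathbf{ep}$ be the cardinality of the set of subtoposes of $\mathsf{PSh}(P)$ with enough points, i.e. of the $J$ such that $\mathsf{Sh}(P,J)$ has enough points; - $\mathbf{gt}$ be the cardinality of the set of all Grothendieck topologies on $P$. Here an object of a topos is compact if every epimorphic family with that codomain contains a finite epimorphic subfamily; it is coherent if it is compact and the pullback of any diagram of compact objects over it is compact; a topos is coherent if it contains a full subcategory of compact generators closed under finite limits. Then $$\mathbf{x} = \mathbf{cl} = \mathbf{coh} = 2^{\omega} \qquad\text{and}\qquad \mathbf{ep} = \mathbf{gt} = 2^{(2^{\omega})}.$$ -/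

import Mathlib

open CategoryTheory CategoryTheory.Limits
open scoped Cardinal

universe v u

/-! ### Compact and coherent objects, coherent toposes -/

section Topos

variable {E : Type u} [Category.{v} E]

/-- A family of morphisms with common codomain `X` is epimorphic if two morphisms out of `X`
that agree after composition with every member of the family are equal. -/
def IsEpimorphicFamily {ι : Type*} {X : E} {Y : ι → E} (f : ∀ i, Y i ⟶ X) : Prop :=
  ∀ ⦃Z : E⦄ (g h : X ⟶ Z), (∀ i, f i ≫ g = f i ≫ h) → g = h

/-- An object is compact if every (small) epimorphic family with this codomain
contains a finite epimorphic subfamily. -/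
def IsCompactObject (X : E) : Prop :=
  ∀ ⦃ι : Type v⦄ (Y : ι → E) (f : ∀ i, Y i ⟶ X), IsEpimorphicFamily f →
    ∃ s : Finset ι, IsEpimorphicFamily (fun i : s => f i)

/-- An object `X` is coherent if it is compact and if the pullback of every diagram
`A ⟶ X ⟵ B` with `A` and `B` compact is compact. -/
def IsCoherentObject (X : E) : Prop :=
  IsCompactObject X ∧
    ∀ ⦃Q A B : E⦄ (p : Q ⟶ A) (q : Q ⟶ B) (f : A ⟶ X) (g : B ⟶ X),
      IsCompactObject A → IsCompactObject B → IsPullback p q f g → IsCompactObject Q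

variable (E) in
/-- A topos is coherent if it contains a full subcategory of compact generators that is closed
under finite limits. -/
def IsCoherentTopos : Prop :=
  ∃ K : ObjectProperty E,
    (∀ X : E, K X → IsCompactObject X) ∧
    K.IsSeparating ∧
    ∀ (S : Type) [SmallCategory S] [FinCategory S], K.IsClosedUnderLimitsOfShape S

end Topos

/-! ### Subtoposes of a presheaf topos

The subtoposes of `PSh(C)`, for a small category `C`, are the full subcategories `Sh(C, J)` for
the Grothendieck topologies `J` on `C`, and distinct topologies give distinct subtoposes. -/

section Subtopos

variable {C : Type u} [SmallCategory C]

/-- The subtopos `Sh(C, J)` of `PSh(C)` is closed: for some subterminal presheaf `U`, it is the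
closed complement of the open subtopos associated with `U`, that is, the full subcategory on the
presheaves `F` such that the projection `F × U ⟶ U` is an isomorphism. -/
def IsClosedSubtopos (J : GrothendieckTopology C) : Prop :=
  ∃ U : Cᵒᵖ ⥤ Type u, IsSubterminal U ∧
    ∀ F : Cᵒᵖ ⥤ Type u, Presheaf.IsSheaf J F ↔ IsIso (prod.snd : F ⨯ U ⟶ U)

/-- `Sh(C, J)` is a coherent subtopos of the coherent topos `PSh(C)`: it is a coherent topos, and
the inverse image functor of the inclusion (sheafification) preserves coherent objects. -/
def IsCoherentSubtopos (J : GrothendieckTopology C) : Prop :=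
  IsCoherentTopos (Cᵒᵖ ⥤ Type u) ∧
  IsCoherentTopos (Sheaf J (Type u)) ∧
  ∀ F : Cᵒᵖ ⥤ Type u, IsCoherentObject F →
    IsCoherentObject ((presheafToSheaf J (Type u)).obj F)

end Subtopos

/-! ### The big cell and the supernatural numbers -/

/-- The set of positive integers, to be ordered by reverse divisibility. -/
@[ext]
structure BigCell where
  /-- The underlying positive integer. -/
  val : ℕ+

/-- `m ≤ n` if and only if `n` divides `m`. The associated category (one morphism `m ⟶ n` when
`m ≤ n`) is Mathlib's `Preorder.smallCategory`. -/
instance : PartialOrder BigCell where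
  le m n := n.val ∣ m.val
  le_refl m := dvd_refl m.val
  le_trans _ _ _ h₁ h₂ := dvd_trans h₂ h₁
  le_antisymm _ _ h₁ h₂ := BigCell.ext (PNat.dvd_antisymm h₂ h₁)

/-- A supernatural number `∏ q ^ e q` (product over all primes `q`) is given by its exponents
`e q ∈ {0, 1, 2, …, ∞}`; divisibility is the pointwise order on exponents. -/
abbrev Supernatural : Type := Nat.Primes → ℕ∞

/-!
Over a site, an object is compact when every locally generating family of its sections contains
a finite one. If every covering sieve contains a finitely generated one, compactness of a sheaf
means that finitely many sections generate it locally, a property that sheafification preserves.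
It follows that, over a finitely complete poset, the coherent subtoposes are exactly those of the
finitary topologies: conversely, compactness of the sheafified representables provides the finite
covers. A finitary topology on a countable category is determined by a set of finite families of
arrows, so there are at most `2 ^ ℵ₀` of them. The topology of a closed subtopos is finitary,
since all its nonmaximal covers come from the empty cover, and the closed subtoposes already
distinguish the lower sets generated by sets of primes.

A filter on the positive integers is determined by the prime powers it contains, and hence by a
supernatural number. Every set `Y` of filters defines a topology with enough points, whose covers
are the sieves that meet all relevant members of `Y`. If `Y` varies among the subsets of an
antichain, then distinct sets give distinct topologies, and there is an antichain of `2 ^ ℵ₀`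
filters. In the other direction, a countable category has at most `2 ^ ℵ₀` sieves, hence at most
`2 ^ 2 ^ ℵ₀` topologies.
-/

open Opposite

section LocalGeneration

variable {C : Type u} [SmallCategory C] {J : GrothendieckTopology C} {X Y Z : Cᵒᵖ ⥤ Type u}

lemma sheafify_eq_top_of_le_sheafify {G G' : Subfunctor X} (hG : G.sheafify J = ⊤)
    (h : G ≤ G'.sheafify J) : G'.sheafify J = ⊤ := by
  refine eq_top_iff.2 fun c x _ => ?_
  have hx : x ∈ (G.sheafify J).obj c := hG ▸ trivial
  refine J.transitive hx _ fun d f hf => J.superset_covering (fun e g hg => ?_) (h _ hf)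
  simpa using hg

lemma sheafify_eq_top_iff_forall_hom_eq {G : Subfunctor X} :
    G.sheafify J = ⊤ ↔
      ∀ ⦃Z : Sheaf J (Type u)⦄ (g h : X ⟶ Z.obj), G.ι ≫ g = G.ι ≫ h → g = h := by
  rw [← Subfunctor.range_ι G, ← Presheaf.isLocallySurjective_iff_range_sheafify_eq_top',
    Subfunctor.range_ι, ← Presheaf.isLocallySurjective_presheafToSheaf_map_iff,
    Sheaf.isLocallySurjective_iff_epi]
  have homEquiv_naturality {Z : Sheaf J (Type u)} (g : X ⟶ Z.obj) :=
    (sheafificationAdjunction J (Type u)).homEquiv_naturality_left_symm G.ι g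
  constructor
  · intro _ Z g h hgh
    refine ((sheafificationAdjunction J _).homEquiv X Z).symm.injective ?_
    rw [← cancel_epi ((presheafToSheaf J (Type u)).map G.ι), ← homEquiv_naturality, hgh,
      homEquiv_naturality]
  · intro H
    refine ⟨fun {Z} g h hgh => ?_⟩
    obtain ⟨g, rfl⟩ := ((sheafificationAdjunction J _).homEquiv X Z).symm.surjective g
    obtain ⟨h, rfl⟩ := ((sheafificationAdjunction J _).homEquiv X Z).symm.surjective h
    rw [← homEquiv_naturality, ← homEquiv_naturality, EmbeddingLike.apply_eq_iff_eq] at hgh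
    rw [H g h hgh]

/-- The smallest subpresheaf that contains a family of sections. -/
def generatedSubfunctor {ι : Type*} {c : ι → C} (x : ∀ i, X.obj (op (c i))) : Subfunctor X :=
  ⨆ i, Subfunctor.ofSection (x i)

/-- A family of sections generates a presheaf locally for `J` if every section is, on a covering
sieve, a restriction of members of the family. -/
def IsLocallyGeneratedBy (J : GrothendieckTopology C) {ι : Type*} {c : ι → C}
    (x : ∀ i, X.obj (op (c i))) : Prop :=
  (generatedSubfunctor x).sheafify J = ⊤

variable {ι : Type*} {c : ι → C} {x : ∀ i, X.obj (op (c i))}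

lemma generatedSubfunctor_le_iff {G : Subfunctor X} :
    generatedSubfunctor x ≤ G ↔ ∀ i, x i ∈ G.obj (op (c i)) := by
  simp only [generatedSubfunctor, iSup_le_iff, Subfunctor.ofSection_le_iff]

lemma mem_generatedSubfunctor_iff {d : C} {y : X.obj (op d)} :
    y ∈ (generatedSubfunctor x).obj (op d) ↔
      ∃ (i : ι) (f : d ⟶ c i), X.map f.op (x i) = y := by
  simp only [generatedSubfunctor, Subfunctor.iSup_obj, Set.mem_iUnion]
  exact exists_congr fun i => ⟨fun ⟨f, hf⟩ => ⟨f.unop, hf⟩, fun ⟨f, hf⟩ => ⟨f.op, hf⟩⟩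

lemma mem_generatedSubfunctor (i : ι) : x i ∈ (generatedSubfunctor x).obj (op (c i)) :=
  generatedSubfunctor_le_iff.1 le_rfl i

lemma image_generatedSubfunctor (f : X ⟶ Y) :
    (generatedSubfunctor x).image f = generatedSubfunctor fun i => f.app _ (x i) := by
  simp only [generatedSubfunctor, Subfunctor.image_iSup, Subfunctor.ofSection_image]

lemma generatedSubfunctor_ι_comp_eq_iff (g h : X ⟶ Z) :
    (generatedSubfunctor x).ι ≫ g = (generatedSubfunctor x).ι ≫ h ↔
      ∀ i, g.app _ (x i) = h.app _ (x i) := by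
  rw [← Subfunctor.equalizer_eq_iff, ← (Subfunctor.equalizer_le _ _).ge_iff_eq,
    generatedSubfunctor_le_iff]
  exact forall_congr' fun i =>
    Subfunctor.mem_equalizer_iff _ _ ⟨x i, mem_generatedSubfunctor i⟩

lemma isLocallyGeneratedBy_iff_forall_hom_eq :
    IsLocallyGeneratedBy J x ↔ ∀ ⦃Z : Sheaf J (Type u)⦄ (g h : X ⟶ Z.obj),
      (∀ i, g.app _ (x i) = h.app _ (x i)) → g = h := by
  simp only [IsLocallyGeneratedBy, sheafify_eq_top_iff_forall_hom_eq,
    generatedSubfunctor_ι_comp_eq_iff]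

lemma isLocallyGeneratedBy_app_iff (f : X ⟶ Y) :
    IsLocallyGeneratedBy J (fun i => f.app _ (x i)) ↔
      Presheaf.IsLocallySurjective J ((generatedSubfunctor x).ι ≫ f) := by
  rw [Presheaf.isLocallySurjective_iff_range_sheafify_eq_top', Subfunctor.range_comp,
    Subfunctor.range_ι, image_generatedSubfunctor, IsLocallyGeneratedBy]

lemma isLocallyGeneratedBy_iff_isLocallySurjective :
    IsLocallyGeneratedBy J x ↔ Presheaf.IsLocallySurjective J (generatedSubfunctor x).ι := by
  simpa using isLocallyGeneratedBy_app_iff (𝟙 X)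

lemma IsLocallyGeneratedBy.map (hx : IsLocallyGeneratedBy J x) (f : X ⟶ Y)
    [Presheaf.IsLocallySurjective J f] : IsLocallyGeneratedBy J fun i => f.app _ (x i) := by
  rw [isLocallyGeneratedBy_iff_isLocallySurjective] at hx
  rw [isLocallyGeneratedBy_app_iff]
  infer_instance

lemma IsLocallyGeneratedBy.of_map {f : X ⟶ Y} [Presheaf.IsLocallyInjective J f]
    (h : IsLocallyGeneratedBy J fun i => f.app _ (x i)) : IsLocallyGeneratedBy J x := by
  rw [isLocallyGeneratedBy_app_iff] at h
  rw [isLocallyGeneratedBy_iff_isLocallySurjective]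
  exact Presheaf.isLocallySurjective_of_isLocallySurjective_of_isLocallyInjective J _ f

lemma IsLocallyGeneratedBy.trans (hx : IsLocallyGeneratedBy J x) {κ : Type*} {d : κ → C}
    {y : ∀ k, X.obj (op (d k))}
    (h : ∀ i, x i ∈ ((generatedSubfunctor y).sheafify J).obj (op (c i))) :
    IsLocallyGeneratedBy J y :=
  sheafify_eq_top_of_le_sheafify hx (generatedSubfunctor_le_iff.2 h)

lemma IsLocallyGeneratedBy.mono (hx : IsLocallyGeneratedBy J x) {J' : GrothendieckTopology C}
    (h : J ≤ J') : IsLocallyGeneratedBy J' x := by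
  rw [isLocallyGeneratedBy_iff_isLocallySurjective] at hx ⊢
  exact Presheaf.isLocallySurjective_of_le h _ hx

variable (J) in
lemma isLocallyGeneratedBy_yoneda (c : C) :
    IsLocallyGeneratedBy J (X := yoneda.obj c) fun _ : PUnit.{u + 1} => 𝟙 c := by
  refine eq_top_iff.2 fun d f _ => Subfunctor.le_sheafify J _ _ ?_
  exact mem_generatedSubfunctor_iff.2 ⟨⟨⟩, f, by simp⟩

end LocalGeneration

section CompactObjects

lemma isCompactObject_iff_of_isSeparating {E : Type*} [Category.{v} E] {κ : Type v} {G : κ → E}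
    (hG : (ObjectProperty.ofObj G).IsSeparating) (X : E) :
    IsCompactObject X ↔ ∀ (ι : Type v) (c : ι → κ) (f : ∀ i, G (c i) ⟶ X),
      IsEpimorphicFamily f → ∃ s : Finset ι, IsEpimorphicFamily fun i : s => f i := by
  classical
  refine ⟨fun hX ι c f hf => hX _ f hf, fun H ι Y f hf => ?_⟩
  obtain ⟨s, hs⟩ := H (Σ (i : ι) (k : κ), G k ⟶ Y i) (fun a => a.2.1) (fun a => a.2.2 ≫ f a.1) <| by
    refine fun Z g h hgh => hf g h fun i => hG _ _ ?_
    rintro _ ⟨k⟩ a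
    simpa only [Category.assoc] using hgh ⟨i, k, a⟩
  refine ⟨s.image Sigma.fst, fun Z g h hgh => hs g h fun a => ?_⟩
  simp only [Category.assoc]
  rw [hgh ⟨a.1.1, Finset.mem_image_of_mem _ a.2⟩]

variable {C : Type u} [SmallCategory C] (J : GrothendieckTopology C)

/-- Compactness of an object of a Grothendieck topos, expressed through sections over a site:
every locally generating family of sections contains a finite one. -/
def IsLocallyCompact (X : Cᵒᵖ ⥤ Type u) : Prop :=
  ∀ (ι : Type u) (c : ι → C) (x : ∀ i, X.obj (op (c i))), IsLocallyGeneratedBy J x →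
    ∃ s : Finset ι, IsLocallyGeneratedBy J fun i : s => x i

section Presheaf

variable {X Z : Cᵒᵖ ⥤ Type u}

lemma yonedaEquiv_symm_comp_eq_iff {c : C} (x : X.obj (op c)) (g h : X ⟶ Z) :
    yonedaEquiv.symm x ≫ g = yonedaEquiv.symm x ≫ h ↔ g.app _ x = h.app _ x := by
  rw [yonedaEquiv_symm_naturality_right, yonedaEquiv_symm_naturality_right,
    yonedaEquiv.symm.injective.eq_iff]

lemma isSeparating_yoneda :
    (ObjectProperty.ofObj fun c : C => yoneda.obj c).IsSeparating := by
  intro X Z g h H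
  ext c x
  exact (yonedaEquiv_symm_comp_eq_iff x g h).1 (H _ ⟨c.unop⟩ _)

lemma isEpimorphicFamily_yonedaEquiv_symm_iff {ι : Type*} {c : ι → C}
    (x : ∀ i, X.obj (op (c i))) :
    IsEpimorphicFamily (fun i => yonedaEquiv.symm (x i)) ↔ IsLocallyGeneratedBy ⊥ x := by
  simp only [isLocallyGeneratedBy_iff_forall_hom_eq, IsEpimorphicFamily,
    yonedaEquiv_symm_comp_eq_iff]
  have isSheaf_bot (Z : Cᵒᵖ ⥤ Type u) : Presheaf.IsSheaf ⊥ Z :=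
    (isSheaf_iff_isSheaf_of_type _ _).2 Presieve.isSheaf_bot
  exact ⟨fun H Z => @H Z.obj, fun H Z => @H ⟨Z, isSheaf_bot Z⟩⟩

theorem isCompactObject_presheaf_iff_isLocallyCompact :
    IsCompactObject X ↔ IsLocallyCompact ⊥ X := by
  rw [isCompactObject_iff_of_isSeparating isSeparating_yoneda]
  refine forall₂_congr fun ι c =>
    (Equiv.piCongrRight fun _ => yonedaEquiv.symm).forall_congr_right.symm.trans ?_
  exact forall_congr' fun x => imp_congr (isEpimorphicFamily_yonedaEquiv_symm_iff x)
    (exists_congr fun s => isEpimorphicFamily_yonedaEquiv_symm_iff _)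

end Presheaf

section Sheaf

variable {J} {X Z : Sheaf J (Type u)}

/-- The Yoneda lemma for sheaves: the morphisms out of the sheafification of a representable
presheaf are the sections over the representing object. -/
noncomputable def sectionEquiv (X : Sheaf J (Type u)) (c : C) :
    X.obj.obj (op c) ≃ ((presheafToSheaf J (Type u)).obj (yoneda.obj c) ⟶ X) :=
  yonedaEquiv.symm.trans ((sheafificationAdjunction J (Type u)).homEquiv _ _).symm

lemma sectionEquiv_comp_eq_iff {c : C} (x : X.obj.obj (op c)) (g h : X ⟶ Z) :
    sectionEquiv X c x ≫ g = sectionEquiv X c x ≫ h ↔ g.hom.app _ x = h.hom.app _ x := by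
  have naturality (k : X ⟶ Z) : sectionEquiv X c x ≫ k =
      ((sheafificationAdjunction J (Type u)).homEquiv _ _).symm (yonedaEquiv.symm x ≫ k.hom) :=
    (Adjunction.homEquiv_naturality_right_symm _ _ k).symm
  rw [naturality, naturality, EmbeddingLike.apply_eq_iff_eq]
  exact yonedaEquiv_symm_comp_eq_iff x g.hom h.hom

variable (J) in
lemma isSeparating_presheafToSheaf_yoneda :
    (ObjectProperty.ofObj fun c : C => (presheafToSheaf J (Type u)).obj (yoneda.obj c)).IsSeparating
    := by
  intro X Z g h H
  refine Sheaf.hom_ext ?_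
  ext c x
  exact (sectionEquiv_comp_eq_iff x g h).1 (H _ ⟨c.unop⟩ _)

lemma isEpimorphicFamily_sectionEquiv_iff {ι : Type*} {c : ι → C}
    (x : ∀ i, X.obj.obj (op (c i))) :
    IsEpimorphicFamily (fun i => sectionEquiv X (c i) (x i)) ↔ IsLocallyGeneratedBy J x := by
  simp only [isLocallyGeneratedBy_iff_forall_hom_eq, IsEpimorphicFamily, sectionEquiv_comp_eq_iff]
  exact ⟨fun H Z g h e => congr_arg (·.hom) (@H Z ⟨g⟩ ⟨h⟩ e),
    fun H Z g h e => Sheaf.hom_ext (@H Z g.hom h.hom e)⟩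

theorem isCompactObject_sheaf_iff_isLocallyCompact :
    IsCompactObject X ↔ IsLocallyCompact J X.obj := by
  rw [isCompactObject_iff_of_isSeparating (isSeparating_presheafToSheaf_yoneda J)]
  refine forall₂_congr fun ι c =>
    (Equiv.piCongrRight fun i => sectionEquiv X (c i)).forall_congr_right.symm.trans ?_
  exact forall_congr' fun x => imp_congr (isEpimorphicFamily_sectionEquiv_iff x)
    (exists_congr fun s => isEpimorphicFamily_sectionEquiv_iff _)

end Sheaf

end CompactObjects

section Finitary

variable {C : Type u} [SmallCategory C] {J : GrothendieckTopology C} {X Y : Cᵒᵖ ⥤ Type u}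

/-- A topology is finitary if every covering sieve contains a finitely generated covering
sieve. -/
def IsFinitary (J : GrothendieckTopology C) : Prop :=
  ∀ ⦃c : C⦄, ∀ S ∈ J c, ∃ R : Presieve c, R ≤ S.arrows ∧ R.uncurry.Finite ∧ Sieve.generate R ∈ J c

/-- A presheaf is locally finitely generated if finitely many of its sections generate it
locally. -/
def IsLocallyFG (J : GrothendieckTopology C) (X : Cᵒᵖ ⥤ Type u) : Prop :=
  ∃ (ι : Type u) (_ : Finite ι) (c : ι → C) (x : ∀ i, X.obj (op (c i))), IsLocallyGeneratedBy J x

lemma IsLocallyFG.mono (hX : IsLocallyFG J X) {J' : GrothendieckTopology C} (h : J ≤ J') :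
    IsLocallyFG J' X := by
  obtain ⟨ι, _, c, x, hx⟩ := hX
  exact ⟨ι, inferInstance, c, x, hx.mono h⟩

lemma IsLocallyFG.map (hX : IsLocallyFG J X) (f : X ⟶ Y) [Presheaf.IsLocallySurjective J f] :
    IsLocallyFG J Y := by
  obtain ⟨ι, _, c, x, hx⟩ := hX
  exact ⟨ι, inferInstance, c, _, hx.map f⟩

lemma isFinitary_of_forall_eq_top_or_bot_mem
    (h : ∀ ⦃c : C⦄, ∀ S ∈ J c, S = ⊤ ∨ ⊥ ∈ J c) : IsFinitary J := by
  intro c S hS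
  obtain rfl | h := h S hS
  · exact ⟨.singleton (𝟙 c), fun _ _ _ => trivial, by simp, by simp⟩
  · exact ⟨⊥, bot_le, Set.finite_empty.subset fun _ h => h.elim, by simpa using h⟩

lemma isFinitary_bot : IsFinitary (⊥ : GrothendieckTopology C) :=
  isFinitary_of_forall_eq_top_or_bot_mem fun _ _ hS => Or.inl hS

lemma IsFinitary.isLocallyCompact (hJ : IsFinitary J) (hX : IsLocallyFG J X) :
    IsLocallyCompact J X := by
  classical
  obtain ⟨ι, _, c, x, hx⟩ := hX
  intro κ d y hy
  have hxy (i : ι) : x i ∈ ((generatedSubfunctor y).sheafify J).obj (op (c i)) := hy ▸ trivial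
  choose R hR hfin hcov using fun i => hJ _ (hxy i)
  choose k f hkf using fun (a : Σ i, (R i).uncurry) =>
    mem_generatedSubfunctor_iff.1 (hR a.1 _ _ a.2.2)
  have (i : ι) : Finite (R i).uncurry := hfin i
  refine ⟨(Set.finite_range k).toFinset, hx.trans fun i => J.superset_covering ?_ (hcov i)⟩
  refine (Sieve.generate_le_iff _ _).2 fun e g hg => mem_generatedSubfunctor_iff.2 ?_
  let a : Σ i, (R i).uncurry := ⟨i, ⟨_, g⟩, hg⟩
  exact ⟨⟨k a, by simp⟩, f a, hkf a⟩

lemma IsLocallyCompact.isLocallyFG (hX : IsLocallyCompact J X) : IsLocallyFG J X := by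
  obtain ⟨s, hs⟩ := hX (Σ c : C, X.obj (op c)) Sigma.fst Sigma.snd <|
    eq_top_iff.2 fun d x _ => Subfunctor.le_sheafify J _ _ <|
      mem_generatedSubfunctor (x := fun p : Σ c : C, X.obj (op c) => p.2) ⟨d.unop, x⟩
  exact ⟨s, inferInstance, _, _, hs⟩

lemma IsLocallyCompact.of_map (hY : IsLocallyCompact J Y) (η : X ⟶ Y)
    [Presheaf.IsLocallySurjective J η] [Presheaf.IsLocallyInjective J η] :
    IsLocallyCompact J X :=
  fun ι _ _ hx => (hY ι _ _ (hx.map η)).imp fun _ hs => hs.of_map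

variable (J) in
lemma isLocallyFG_yoneda (c : C) : IsLocallyFG J (yoneda.obj c) :=
  ⟨PUnit, inferInstance, _, _, isLocallyGeneratedBy_yoneda J c⟩

lemma isFinitary_of_isLocallyCompact_yoneda (H : ∀ c : C, IsLocallyCompact J (yoneda.obj c)) :
    IsFinitary J := by
  intro c S hS
  have hgen : IsLocallyGeneratedBy J (X := yoneda.obj c) fun f : S.arrows.uncurry => f.1.2 := by
    refine (isLocallyGeneratedBy_yoneda J c).trans fun _ =>
      J.superset_covering (fun d f hf => ?_) hS
    exact mem_generatedSubfunctor_iff.2 ⟨⟨⟨d, f⟩, hf⟩, 𝟙 d, by simp⟩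
  obtain ⟨s, hs⟩ := H c _ _ _ hgen
  refine ⟨.ofArrows _ fun f : s => f.1.1.2, ?_, ?_, ?_⟩
  · rintro _ _ ⟨f⟩
    exact f.1.2
  · simpa using Set.finite_range _
  · have hid : 𝟙 c ∈ ((generatedSubfunctor (X := yoneda.obj c)
        fun f : s => f.1.1.2).sheafify J).obj (op c) := hs ▸ trivial
    refine J.superset_covering (fun d f hf => ?_) hid
    obtain ⟨g, h, hgh⟩ := mem_generatedSubfunctor_iff.1 hf
    exact ⟨_, h, _, ⟨g⟩, by simpa using hgh⟩

theorem isFinitary_of_isCompactObject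
    (H : ∀ c : C, IsCompactObject ((presheafToSheaf J (Type u)).obj (yoneda.obj c))) :
    IsFinitary J :=
  isFinitary_of_isLocallyCompact_yoneda fun c =>
    (isCompactObject_sheaf_iff_isLocallyCompact.1 (H c)).of_map (toSheafify J (yoneda.obj c))

lemma isCompactObject_presheaf_iff_isLocallyFG : IsCompactObject X ↔ IsLocallyFG ⊥ X :=
  isCompactObject_presheaf_iff_isLocallyCompact.trans
    ⟨IsLocallyCompact.isLocallyFG, isFinitary_bot.isLocallyCompact⟩

lemma isCompactObject_yoneda (c : C) : IsCompactObject (yoneda.obj c) :=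
  isCompactObject_presheaf_iff_isLocallyFG.2 (isLocallyFG_yoneda ⊥ c)

lemma IsFinitary.isCompactObject_sheaf_iff_isLocallyFG (hJ : IsFinitary J) {X : Sheaf J (Type u)} :
    IsCompactObject X ↔ IsLocallyFG J X.obj :=
  isCompactObject_sheaf_iff_isLocallyCompact.trans
    ⟨IsLocallyCompact.isLocallyFG, hJ.isLocallyCompact⟩

lemma IsFinitary.isCompactObject_presheafToSheaf (hJ : IsFinitary J) (hX : IsCompactObject X) :
    IsCompactObject ((presheafToSheaf J (Type u)).obj X) :=
  hJ.isCompactObject_sheaf_iff_isLocallyFG.2 <|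
    ((isCompactObject_presheaf_iff_isLocallyFG.1 hX).mono bot_le).map (toSheafify J X)

end Finitary

section CoherentObjects

variable {C : Type u} [SmallCategory C] {J : GrothendieckTopology C}
  {Q A B F G : Cᵒᵖ ⥤ Type u}

lemma isLocallyFG_of_iSup_range {ι : Type u} [Finite ι] {R : ι → Cᵒᵖ ⥤ Type u}
    (hR : ∀ i, IsLocallyFG J (R i)) (h : ∀ i, R i ⟶ Q)
    (hQ : (⨆ i, Subfunctor.range (h i)).sheafify J = ⊤) : IsLocallyFG J Q := by
  choose κ _ c x hx using hR
  refine ⟨Σ i, κ i, inferInstance, fun a => c a.1 a.2, fun a => (h a.1).app _ (x a.1 a.2),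
    sheafify_eq_top_of_le_sheafify hQ (iSup_le fun i => ?_)⟩
  rintro e _ ⟨r, rfl⟩
  have hr : r ∈ ((generatedSubfunctor (x i)).sheafify J).obj e := hx i ▸ trivial
  refine J.superset_covering (fun d f hf => ?_) hr
  obtain ⟨k, g, hg⟩ := mem_generatedSubfunctor_iff.1 hf
  refine mem_generatedSubfunctor_iff.2 ⟨⟨i, k⟩, g, ?_⟩
  rw [← NatTrans.naturality_apply, hg, NatTrans.naturality_apply]

lemma exists_of_isPullback {p : Q ⟶ A} {q : Q ⟶ B} {f : A ⟶ F} {g : B ⟶ F}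
    (h : IsPullback p q f g) {c : Cᵒᵖ} (a : A.obj c) (b : B.obj c)
    (hab : f.app c a = g.app c b) : ∃ z, p.app c z = a ∧ q.app c z = b :=
  Types.exists_of_isPullback (h.map ((evaluation Cᵒᵖ (Type u)).obj c)) a b hab

lemma ext_of_isPullback {p : Q ⟶ A} {q : Q ⟶ B} {f : A ⟶ F} {g : B ⟶ F}
    (h : IsPullback p q f g) {c : Cᵒᵖ} {z z' : Q.obj c}
    (hp : p.app c z = p.app c z') (hq : q.app c z = q.app c z') : z = z' :=
  Types.ext_of_isPullback (h.map ((evaluation Cᵒᵖ (Type u)).obj c)) hp hq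

lemma app_app_eq_app_app {p : Q ⟶ A} {q : Q ⟶ B} {f : A ⟶ F} {g : B ⟶ F}
    (w : p ≫ f = q ≫ g) {c : Cᵒᵖ} (z : Q.obj c) : f.app c (p.app c z) = g.app c (q.app c z) :=
  ConcreteCategory.congr_hom (NatTrans.congr_app w c) z

lemma isLocallyFG_of_isPullback {p : Q ⟶ A} {q : Q ⟶ B} {f : A ⟶ F} {g : B ⟶ F}
    (hpb : IsPullback p q f g) {ι κ : Type u} [Finite ι] [Finite κ] {c : ι → C} {d : κ → C}
    {a : ∀ i, A.obj (op (c i))} (ha : IsLocallyGeneratedBy J a)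
    {b : ∀ k, B.obj (op (d k))} (hb : IsLocallyGeneratedBy J b)
    (H : ∀ i k, IsLocallyFG J
      (pullback (yonedaEquiv.symm (a i) ≫ f) (yonedaEquiv.symm (b k) ≫ g))) :
    IsLocallyFG J Q := by
  let lift (i : ι) (k : κ) := hpb.lift
    (pullback.fst (yonedaEquiv.symm (a i) ≫ f) (yonedaEquiv.symm (b k) ≫ g) ≫
      yonedaEquiv.symm (a i))
    (pullback.snd _ _ ≫ yonedaEquiv.symm (b k))
    (by simpa only [Category.assoc] using pullback.condition)
  refine isLocallyFG_of_iSup_range (fun s : ι × κ => H s.1 s.2) (fun s => lift s.1 s.2)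
    (eq_top_iff.2 fun e w _ => ?_)
  have hpw : p.app _ w ∈ ((generatedSubfunctor a).sheafify J).obj e := ha ▸ trivial
  have hqw : q.app _ w ∈ ((generatedSubfunctor b).sheafify J).obj e := hb ▸ trivial
  refine J.superset_covering ?_ (J.intersection_covering hpw hqw)
  rintro e' m ⟨hp, hq⟩
  obtain ⟨i, s, hs⟩ := mem_generatedSubfunctor_iff.1 hp
  obtain ⟨k, t, ht⟩ := mem_generatedSubfunctor_iff.1 hq
  obtain ⟨z, rfl, rfl⟩ := exists_of_isPullback (IsPullback.of_hasPullback
    (yonedaEquiv.symm (a i) ≫ f) (yonedaEquiv.symm (b k) ≫ g)) (c := op e') s t <| by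
      simp [yonedaEquiv_symm_app_apply, hs, ht, app_app_eq_app_app hpb.w]
  have hz : (lift i k).app _ z = Q.map m.op w := by
    refine ext_of_isPullback hpb ?_ ?_
    · refine (app_app_eq_app_app (hpb.lift_fst _ _ _) z).trans ?_
      simpa [yonedaEquiv_symm_app_apply] using hs
    · refine (app_app_eq_app_app (hpb.lift_snd _ _ _) z).trans ?_
      simpa [yonedaEquiv_symm_app_apply] using ht
  exact le_iSup (fun s : ι × κ => Subfunctor.range (lift s.1 s.2)) (i, k) _ ⟨z, hz⟩

instance isLocallySurjective_mapDesc (f : A ⟶ F) (g : B ⟶ F) (η : F ⟶ G)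
    [Presheaf.IsLocallyInjective J η] :
    Presheaf.IsLocallySurjective J (pullback.mapDesc f g η) where
  imageSieve_mem {e} z := by
    have hz := app_app_eq_app_app (pullback.condition (f := f ≫ η) (g := g ≫ η)) z
    refine J.superset_covering (fun d h hd => ?_) (Presheaf.equalizerSieve_mem J η _ _ hz)
    obtain ⟨z', hf, hg⟩ := exists_of_isPullback (IsPullback.of_hasPullback f g)
      (A.map h.op ((pullback.fst (f ≫ η) (g ≫ η)).app _ z))
      (B.map h.op ((pullback.snd (f ≫ η) (g ≫ η)).app _ z))
      (by rw [NatTrans.naturality_apply, NatTrans.naturality_apply]; exact hd)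
    refine ⟨z', ext_of_isPullback (IsPullback.of_hasPullback _ _) ?_ ?_⟩
    · refine (app_app_eq_app_app (pullback.lift_fst _ _ _) z').trans ?_
      simpa using hf
    · refine (app_app_eq_app_app (pullback.lift_snd _ _ _) z').trans ?_
      simpa using hg

lemma IsLocallyCompact.exists_isLocallyGeneratedBy_lift (hA : IsLocallyCompact J A) (f : A ⟶ G)
    (η : F ⟶ G) [Presheaf.IsLocallySurjective J η] :
    ∃ (ι : Type u) (_ : Finite ι) (c : ι → C) (a : ∀ i, A.obj (op (c i)))
      (x : ∀ i, F.obj (op (c i))), IsLocallyGeneratedBy J a ∧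
        ∀ i, yonedaEquiv.symm (a i) ≫ f = yonedaEquiv.symm (x i) ≫ η := by
  let I := { p : Σ c : C, A.obj (op c) // ∃ x : F.obj (op p.1), η.app _ x = f.app _ p.2 }
  have hI : IsLocallyGeneratedBy J fun p : I => p.1.2 := by
    refine eq_top_iff.2 fun c a _ =>
      J.superset_covering ?_ (Presheaf.imageSieve_mem J η (f.app _ a))
    rintro d g ⟨x, hx⟩
    let p : I := ⟨⟨d, A.map g.op a⟩, x, hx.trans (NatTrans.naturality_apply f g.op a).symm⟩
    exact mem_generatedSubfunctor (x := fun p : I => p.1.2) p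
  obtain ⟨s, hs⟩ := hA _ _ _ hI
  choose x hx using fun p : I => p.2
  refine ⟨s, inferInstance, _, _, fun i => x i, hs, fun i => ?_⟩
  rw [yonedaEquiv_symm_naturality_right, yonedaEquiv_symm_naturality_right, hx]

theorem IsFinitary.isCoherentObject_presheafToSheaf (hJ : IsFinitary J) (hF : IsCoherentObject F) :
    IsCoherentObject ((presheafToSheaf J (Type u)).obj F) := by
  refine ⟨hJ.isCompactObject_presheafToSheaf hF.1, fun Q A B p q f g hA hB hpb => ?_⟩
  let η := toSheafify J F
  obtain ⟨ι, _, c, a, x, ha, hax⟩ :=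
    (isCompactObject_sheaf_iff_isLocallyCompact.1 hA).exists_isLocallyGeneratedBy_lift f.hom η
  obtain ⟨κ, _, d, b, y, hb, hby⟩ :=
    (isCompactObject_sheaf_iff_isLocallyCompact.1 hB).exists_isLocallyGeneratedBy_lift g.hom η
  have hpb' : IsPullback p.hom q.hom f.hom g.hom := hpb.map (sheafToPresheaf J (Type u))
  refine hJ.isCompactObject_sheaf_iff_isLocallyFG.2 <|
    isLocallyFG_of_isPullback hpb' ha hb fun i k => ?_
  have hxy := hF.2 _ _ (yonedaEquiv.symm (x i)) (yonedaEquiv.symm (y k))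
    (isCompactObject_yoneda _) (isCompactObject_yoneda _) (IsPullback.of_hasPullback _ _)
  simp only [hax, hby]
  exact ((isCompactObject_presheaf_iff_isLocallyFG.1 hxy).mono bot_le).map (pullback.mapDesc _ _ η)

lemma isCoherentObject_yoneda [HasPullbacks C] (c : C) : IsCoherentObject (yoneda.obj c) := by
  refine ⟨isCompactObject_yoneda c, fun Q A B p q f g hA hB hpb => ?_⟩
  obtain ⟨ι, _, d, a, ha⟩ := isCompactObject_presheaf_iff_isLocallyFG.1 hA
  obtain ⟨κ, _, e, b, hb⟩ := isCompactObject_presheaf_iff_isLocallyFG.1 hB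
  refine isCompactObject_presheaf_iff_isLocallyFG.2 <|
    isLocallyFG_of_isPullback hpb ha hb fun i k => ?_
  obtain ⟨s, hs⟩ := yoneda.map_surjective (yonedaEquiv.symm (a i) ≫ f)
  obtain ⟨t, ht⟩ := yoneda.map_surjective (yonedaEquiv.symm (b k) ≫ g)
  simp only [← hs, ← ht]
  exact (isLocallyFG_yoneda ⊥ (pullback s t)).map (PreservesPullback.iso yoneda s t).hom

end CoherentObjects

section CoherentTopos

lemma IsCompactObject.of_iso {E : Type*} [Category.{v} E] {X Y : E} (hX : IsCompactObject X)
    (e : X ≅ Y) : IsCompactObject Y := by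
  intro ι Z f hf
  refine (hX Z (fun i => f i ≫ e.inv) fun W g h H => ?_).imp fun s hs W g h H => ?_
  · rw [← cancel_epi e.inv]
    exact hf _ _ fun i => by simpa using H i
  · rw [← cancel_epi e.hom]
    exact hs _ _ fun i => by simpa using H i

section PreservesFiniteLimits

variable {C : Type*} [Category* C] [HasFiniteLimits C] [Quiver.IsThin C]
  {E : Type u} [Category.{v} E] (F : C ⥤ E) [PreservesFiniteLimits F]

lemma isSubterminal_obj (c : C) : IsSubterminal (F.obj c) := by
  have : Mono (terminal.from c) := ⟨fun _ _ _ => Subsingleton.elim _ _⟩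
  have hT := IsTerminal.isTerminalObj F _ (terminalIsTerminal (C := C))
  have : Mono (hT.from (F.obj c)) := by
    rw [hT.hom_ext (hT.from _) (F.map (terminal.from c))]
    infer_instance
  exact isSubterminal_of_mono_isTerminal_from hT

instance isClosedUnderLimitsOfShape_essImage (S : Type) [SmallCategory S] [FinCategory S] :
    F.essImage.IsClosedUnderLimitsOfShape S where
  limitsOfShape_le := by
    rintro X ⟨p⟩
    choose c hc using p.prop_diag_obj
    let e (j : S) : F.obj (c j) ≅ p.diag.obj j := (hc j).some
    have hom_subsingleton (Z : E) (j : S) : Subsingleton (Z ⟶ p.diag.obj j) :=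
      ⟨fun f g => by simpa using isSubterminal_obj F (c j) (f ≫ (e j).inv) (g ≫ (e j).inv)⟩
    let L : Cone p.diag :=
      { pt := F.obj (∏ᶜ c)
        π := { app j := F.map (Pi.π c j) ≫ (e j).hom } }
    let lift : X ⟶ F.obj (∏ᶜ c) := (isLimitOfHasProductOfPreservesLimit F c).lift
      (Fan.mk X fun j => p.π.app j ≫ (e j).inv)
    exact ⟨∏ᶜ c, ⟨{
      hom := p.isLimit.lift L
      inv := lift
      hom_inv_id := isSubterminal_obj F _ _ _
      inv_hom_id := p.isLimit.hom_ext fun j => Subsingleton.elim _ _ }⟩⟩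

lemma isCoherentTopos_of_preservesFiniteLimits (hF : (ObjectProperty.ofObj F.obj).IsSeparating)
    (hc : ∀ c, IsCompactObject (F.obj c)) : IsCoherentTopos E :=
  ⟨F.essImage, fun _ ⟨c, ⟨e⟩⟩ => (hc c).of_iso e,
    hF.of_le fun _ ⟨c⟩ => F.obj_mem_essImage c, fun _ => inferInstance⟩

end PreservesFiniteLimits

variable {C : Type u} [SmallCategory C] [HasFiniteLimits C] [Quiver.IsThin C]
  {J : GrothendieckTopology C}

variable (C) in
theorem isCoherentTopos_presheaf : IsCoherentTopos (Cᵒᵖ ⥤ Type u) :=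
  isCoherentTopos_of_preservesFiniteLimits yoneda isSeparating_yoneda
    isCompactObject_yoneda

theorem IsFinitary.isCoherentTopos_sheaf (hJ : IsFinitary J) : IsCoherentTopos (Sheaf J (Type u)) :=
  isCoherentTopos_of_preservesFiniteLimits (yoneda ⋙ presheafToSheaf J (Type u))
    (isSeparating_presheafToSheaf_yoneda J)
    fun c => hJ.isCompactObject_presheafToSheaf (isCompactObject_yoneda c)

theorem isCoherentSubtopos_iff_isFinitary : IsCoherentSubtopos J ↔ IsFinitary J :=
  ⟨fun h => isFinitary_of_isCompactObject fun c => (h.2.2 _ (isCoherentObject_yoneda c)).1,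
    fun h => ⟨isCoherentTopos_presheaf C, h.isCoherentTopos_sheaf,
      fun _ hF => h.isCoherentObject_presheafToSheaf hF⟩⟩

end CoherentTopos

section ClosedSubtoposes

variable {C : Type u} [SmallCategory C] {J : GrothendieckTopology C} {F U : Cᵒᵖ ⥤ Type u}

/-- The topology of the closed complement of the open subtopos associated with a subterminal
presheaf `U`: besides the maximal sieves, every sieve on an object over which `U` has a section
covers. Only the support of `U` matters, so subterminality is not part of the definition. -/
def closedTopology (U : Cᵒᵖ ⥤ Type u) : GrothendieckTopology C where
  sieves c := {S | Nonempty (U.obj (op c)) ∨ S = ⊤}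
  top_mem' _ := Or.inr rfl
  pullback_stable' _ _ _ f := by
    rintro (⟨⟨x⟩⟩ | rfl)
    · exact Or.inl ⟨U.map f.op x⟩
    · exact Or.inr Sieve.pullback_top
  transitive' c S hS R H := by
    obtain h | rfl := hS
    · exact Or.inl h
    · simpa using! H (f := 𝟙 c) trivial

lemma mem_closedTopology_iff {c : C} {S : Sieve c} :
    S ∈ closedTopology U c ↔ Nonempty (U.obj (op c)) ∨ S = ⊤ :=
  Iff.rfl

lemma bot_mem_closedTopology_iff {c : C} :
    ⊥ ∈ closedTopology U c ↔ Nonempty (U.obj (op c)) :=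
  or_iff_left fun h => (Sieve.id_mem_iff_eq_top.2 h :)

lemma isFinitary_closedTopology (U : Cᵒᵖ ⥤ Type u) : IsFinitary (closedTopology U) :=
  isFinitary_of_forall_eq_top_or_bot_mem fun _ _ hS =>
    (mem_closedTopology_iff.1 hS).symm.imp_right bot_mem_closedTopology_iff.2

lemma isSheaf_closedTopology_iff :
    Presieve.IsSheaf (closedTopology U) F ↔
      ∀ c, Nonempty (U.obj (op c)) → Nonempty (Unique (F.obj (op c))) := by
  constructor
  · intro h c hc
    obtain ⟨x, -, hx⟩ := h (⊥ : Sieve c) (bot_mem_closedTopology_iff.2 hc)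
      (fun _ _ h => h.elim) (fun _ _ _ _ _ _ _ h => h.elim)
    exact ⟨⟨⟨x⟩, fun y => hx y fun _ _ h => h.elim⟩⟩
  · rintro h c S (⟨⟨u⟩⟩ | rfl)
    · intro x _
      obtain ⟨_⟩ := h c ⟨u⟩
      refine ⟨default, fun d f _ => ?_, fun y _ => Subsingleton.elim _ _⟩
      obtain ⟨_⟩ := h d ⟨U.map f.op u⟩
      exact Subsingleton.elim _ _
    · exact Presieve.isSheafFor_top F

lemma isIso_prod_snd_iff :
    IsIso (prod.snd : F ⨯ U ⟶ U) ↔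
      ∀ c, Nonempty (U.obj (op c)) → Nonempty (Unique (F.obj (op c))) := by
  rw [← FunctorToTypes.binaryProductIso_hom_comp_snd, isIso_comp_left_iff,
    NatTrans.isIso_iff_isIso_app]
  simp only [isIso_iff_bijective]
  constructor
  · rintro h c ⟨u⟩
    obtain ⟨⟨x, -⟩, -⟩ := (h (op c)).2 u
    exact ⟨⟨⟨x⟩, fun y => congr_arg Prod.fst (@(h (op c)).1 (y, u) (x, u) rfl)⟩⟩
  · refine fun h c => ⟨?_, fun u => ?_⟩
    · rintro ⟨x, u⟩ ⟨y, v⟩ huv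
      obtain ⟨_⟩ := h c.unop ⟨u⟩
      exact Prod.ext (Subsingleton.elim x y) huv
    · obtain ⟨_⟩ := h c.unop ⟨u⟩
      exact ⟨(default, u), rfl⟩

theorem isClosedSubtopos_iff :
    IsClosedSubtopos J ↔ ∃ U : Cᵒᵖ ⥤ Type u, IsSubterminal U ∧ J = closedTopology U := by
  refine exists_congr fun U => and_congr_right fun _ => ?_
  rw [topology_eq_iff_same_sheaves]
  refine forall_congr' fun F => ?_
  rw [isIso_prod_snd_iff, ← isSheaf_closedTopology_iff, isSheaf_iff_isSheaf_of_type]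

lemma IsClosedSubtopos.isFinitary (h : IsClosedSubtopos J) : IsFinitary J := by
  obtain ⟨U, -, rfl⟩ := isClosedSubtopos_iff.1 h
  exact isFinitary_closedTopology U

section Preorder

variable {P : Type u} [Preorder P]

/-- The subterminal presheaf supported on a lower set of a preorder. -/
def lowerSetPresheaf (L : LowerSet P) : Pᵒᵖ ⥤ Type u where
  obj d := ULift (PLift (d.unop ∈ L))
  map f := ↾fun x => ⟨⟨L.lower f.unop.le x.down.down⟩⟩

lemma nonempty_lowerSetPresheaf_obj_iff {L : LowerSet P} {d : P} :
    Nonempty ((lowerSetPresheaf L).obj (op d)) ↔ d ∈ L :=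
  ⟨fun ⟨x⟩ => x.down.down, fun h => ⟨⟨⟨h⟩⟩⟩⟩

lemma isSubterminal_lowerSetPresheaf (L : LowerSet P) : IsSubterminal (lowerSetPresheaf L) := by
  intro F f g
  ext d x
  exact Subsingleton.elim (α := ULift (PLift _)) _ _

lemma isClosedSubtopos_closedTopology_lowerSetPresheaf (L : LowerSet P) :
    IsClosedSubtopos (closedTopology (lowerSetPresheaf L)) :=
  isClosedSubtopos_iff.2 ⟨_, isSubterminal_lowerSetPresheaf L, rfl⟩

lemma closedTopology_lowerSetPresheaf_injective :
    Function.Injective fun L : LowerSet P => closedTopology (lowerSetPresheaf L) := by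
  intro L L' (h : closedTopology (lowerSetPresheaf L) = closedTopology (lowerSetPresheaf L'))
  ext d
  rw [SetLike.mem_coe, SetLike.mem_coe, ← nonempty_lowerSetPresheaf_obj_iff,
    ← nonempty_lowerSetPresheaf_obj_iff, ← bot_mem_closedTopology_iff,
    ← bot_mem_closedTopology_iff, h]

end Preorder

end ClosedSubtoposes

section FilterTopologies

open Order

variable {P : Type u} [Preorder P]

/-- The topology in which a sieve covers if it meets every filter in `Y` that contains its
vertex. The filters in `Y` are points of it. -/
def filterTopology (Y : Set (PFilter P)) : GrothendieckTopology P where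
  sieves d := {S | ∀ F ∈ Y, d ∈ F → ∃ e ∈ F, ∃ f : e ⟶ d, S f}
  top_mem' d _ _ hd := ⟨d, hd, 𝟙 d, trivial⟩
  pullback_stable' c d S f hS F hF hd := by
    obtain ⟨e, he, g, hg⟩ := hS F hF (PFilter.mem_of_le f.le hd)
    obtain ⟨e', he', h₁, h₂⟩ := F.directed e he d hd
    refine ⟨e', he', homOfLE h₂, ?_⟩
    rw [Sieve.pullback_apply, Subsingleton.elim (homOfLE h₂ ≫ f) (homOfLE h₁ ≫ g)]
    exact S.downward_closed hg _
  transitive' c S hS R H F hF hc := by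
    obtain ⟨e, he, f, hf⟩ := hS F hF hc
    obtain ⟨e', he', g, hg⟩ := H hf F hF he
    exact ⟨e', he', g ≫ f, hg⟩

lemma mem_filterTopology_iff {Y : Set (PFilter P)} {d : P} {S : Sieve d} :
    S ∈ filterTopology Y d ↔ ∀ F ∈ Y, d ∈ F → ∃ e ∈ F, ∃ f : e ⟶ d, S f :=
  Iff.rfl

/-- The indicator functor of a filter, which is flat because the filter is directed. -/
def filterFiber (F : PFilter P) : P ⥤ Type u where
  obj c := ULift (PLift (c ∈ F))
  map f := ↾fun h => ⟨⟨PFilter.mem_of_le f.le h.down.down⟩⟩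

instance (F : PFilter P) : IsCofiltered (filterFiber F).Elements where
  nonempty :=
    have ⟨c, hc⟩ := F.nonempty
    ⟨⟨c, ⟨⟨hc⟩⟩⟩⟩
  cone_objs := by
    rintro ⟨a, ⟨⟨ha⟩⟩⟩ ⟨b, ⟨⟨hb⟩⟩⟩
    obtain ⟨c, hc, h₁, h₂⟩ := F.directed a ha b hb
    exact ⟨⟨c, ⟨⟨hc⟩⟩⟩, ⟨homOfLE h₁, rfl⟩, ⟨homOfLE h₂, rfl⟩, trivial⟩
  cone_maps a b f g := ⟨a, 𝟙 a, congr_arg (𝟙 a ≫ ·) (Subtype.ext (Subsingleton.elim f.1 g.1))⟩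

/-- The point of `filterTopology Y` given by a member of `Y`. -/
def filterPoint {Y : Set (PFilter P)} (F : Y) :
    GrothendieckTopology.Point.{u} (filterTopology Y) where
  fiber := filterFiber F.1
  initiallySmall := InitiallySmall.mk' (𝟭 _)
  jointly_surjective R hR := by
    rintro ⟨⟨h⟩⟩
    obtain ⟨e, he, f, hf⟩ := hR F.1 F.2 h
    exact ⟨e, f, hf, ⟨⟨he⟩⟩, rfl⟩

lemma hasEnoughPoints_filterTopology (Y : Set (PFilter P)) :
    GrothendieckTopology.HasEnoughPoints.{u} (filterTopology Y) where
  exists_objectProperty := by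
    refine ⟨ObjectProperty.ofObj (filterPoint (Y := Y)), inferInstance,
      ObjectProperty.IsConservativeFamilyOfPoints.mk' fun c S hS F hF hc => ?_⟩
    obtain ⟨e, f, hf, ⟨⟨he⟩⟩, -⟩ :=
      hS ⟨filterPoint ⟨F, hF⟩, ObjectProperty.ofObj_apply _ _⟩ (ULift.up (PLift.up hc))
    exact ⟨e, he, f, hf⟩

variable [OrderTop P]

/-- The sieve of the elements outside a filter, as a sieve on the top element. -/
def complSieve (F : PFilter P) : Sieve (⊤ : P) where
  arrows e _ := e ∉ F
  downward_closed h g he := h (PFilter.mem_of_le g.le he)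

lemma complSieve_mem_filterTopology_iff {Y : Set (PFilter P)} {F : PFilter P} :
    complSieve F ∈ filterTopology Y ⊤ ↔ ∀ G ∈ Y, ¬ G ≤ F := by
  rw [mem_filterTopology_iff]
  refine forall₂_congr fun G _ => ?_
  rw [SetLike.not_le_iff_exists]
  exact ⟨fun h => have ⟨e, he, _, he'⟩ := h PFilter.top_mem; ⟨e, he, he'⟩,
    fun ⟨e, he, he'⟩ _ => ⟨e, he, homOfLE le_top, he'⟩⟩

lemma filterTopology_injOn_powerset {A : Set (PFilter P)} (hA : IsAntichain (· ≤ ·) A) :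
    Set.InjOn filterTopology (𝒫 A) := by
  have mem_iff {Y} (hY : Y ⊆ A) {F} (hF : F ∈ A) :
      F ∈ Y ↔ complSieve F ∉ filterTopology Y ⊤ := by
    simp only [complSieve_mem_filterTopology_iff, not_forall, not_not]
    exact ⟨fun h => ⟨F, h, le_rfl⟩, fun ⟨G, hG, hGF⟩ => hA.eq (hY hG) hF hGF ▸ hG⟩
  intro Y hY Z hZ h
  ext F
  by_cases hF : F ∈ A
  · rw [mem_iff hY hF, mem_iff hZ hF, h]
  · exact iff_of_false (fun h => hF (hY h)) fun h => hF (hZ h)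

end FilterTopologies

section Cardinality

lemma two_power_mk_le_of_injOn_powerset {α β : Type u} {A : Set α} {f : Set α → β}
    (hf : Set.InjOn f (𝒫 A)) : 2 ^ #A ≤ #β := by
  rw [← Cardinal.mk_powerset]
  exact Cardinal.mk_le_of_injective hf.injective

lemma lowerClosure_injOn_powerset {P : Type*} [Preorder P] {A : Set P}
    (hA : IsAntichain (· ≤ ·) A) : Set.InjOn lowerClosure (𝒫 A) := by
  have subset {S T} (hS : S ⊆ A) (hT : T ⊆ A) (h : lowerClosure S = lowerClosure T) : S ⊆ T := by
    intro a ha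
    obtain ⟨b, hb, hab⟩ := mem_lowerClosure.1 (h ▸ subset_lowerClosure ha)
    exact hA.eq (hS ha) (hT hb) hab ▸ hb
  exact fun S hS T hT h => (subset hS hT h).antisymm (subset hT hS h.symm)

lemma exists_injective_isAntichain_range {ι α : Type*} [Infinite ι] [Preorder α] {a b : α}
    (hab : ¬ b ≤ a) :
    ∃ φ : Set ι → ι → α, Function.Injective φ ∧ IsAntichain (· ≤ ·) (Set.range φ) := by
  classical
  obtain ⟨e⟩ : Nonempty (ι ≃ ι × Bool) := by
    have two_le : 2 ≤ #ι := Cardinal.ofNat_le_aleph0.trans (Cardinal.aleph0_le_mk ι)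
    rw [← Cardinal.eq, Cardinal.mk_prod, Cardinal.mk_bool, Cardinal.lift_uzero,
      Cardinal.lift_ofNat, Cardinal.mul_eq_left (Cardinal.aleph0_le_mk ι) two_le two_ne_zero]
  let φ (S : Set ι) (i : ι) : α := if decide ((e i).1 ∈ S) = (e i).2 then b else a
  have eq_of_le {S T} (h : φ S ≤ φ T) : S = T := by
    ext i
    by_contra hi
    have := h (e.symm (i, decide (i ∈ S)))
    simp only [φ, Equiv.apply_symm_apply, if_true, decide_eq_decide, iff_comm, hi, if_false] at this
    exact hab this
  refine ⟨φ, fun S T h => eq_of_le h.le, ?_⟩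
  rintro _ ⟨S, rfl⟩ _ ⟨T, rfl⟩ hne h
  exact hne (congr_arg φ (eq_of_le h))

lemma mk_set_le_of_countable (α : Type u) [Countable α] : #(Set α) ≤ 2 ^ ℵ₀ := by
  rw [Cardinal.mk_set]
  exact Cardinal.power_le_power_left two_ne_zero Cardinal.mk_le_aleph0

variable (C : Type u) [SmallCategory C] [Countable C] [∀ c d : C, Countable (c ⟶ d)]

lemma mk_isFinitary_le : #{J : GrothendieckTopology C // IsFinitary J} ≤ 2 ^ ℵ₀ := by
  let generate (t : Σ c : C, Finset (Σ d : C, d ⟶ c)) : Sieve t.1 :=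
    Sieve.generate fun d f => ⟨d, f⟩ ∈ t.2
  let basis (J : {J : GrothendieckTopology C // IsFinitary J}) :
    Set (Σ c : C, Finset (Σ d : C, d ⟶ c)) := {t | generate t ∈ J.1 t.1}
  have le_of_subset {J K} (h : basis J ⊆ basis K) : J.1 ≤ K.1 := by
    intro c S hS
    obtain ⟨R, hRS, hR, hRJ⟩ := J.2 S hS
    have hmem : ⟨c, hR.toFinset⟩ ∈ basis J := by
      simpa [basis, generate] using! hRJ
    refine K.1.superset_covering ?_ (h hmem)
    rw [Sieve.generate_le_iff]
    exact fun d f hf => hRS d f (hR.mem_toFinset.1 hf)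
  have basis_injective : Function.Injective basis := fun J K h =>
    Subtype.ext ((le_of_subset h.le).antisymm (le_of_subset h.ge))
  exact (Cardinal.mk_le_of_injective basis_injective).trans (mk_set_le_of_countable _)

variable {C} in
lemma mk_sieve_le (c : C) : #(Sieve c) ≤ 2 ^ ℵ₀ := by
  have uncurry_injective : Function.Injective fun S : Sieve c => S.arrows.uncurry := by
    intro S R h
    ext d f
    exact Set.ext_iff.1 h ⟨d, f⟩
  exact (Cardinal.mk_le_of_injective uncurry_injective).trans (mk_set_le_of_countable _)

lemma mk_grothendieckTopology_le : #(GrothendieckTopology C) ≤ 2 ^ ((2 : Cardinal) ^ ℵ₀) := by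
  have mk_sigma_sieve_le : #(Σ c : C, Sieve c) ≤ 2 ^ ℵ₀ := by
    rw [Cardinal.mk_sigma]
    refine (Cardinal.sum_le_sum _ _ mk_sieve_le).trans ?_
    rw [Cardinal.sum_const']
    exact (mul_le_mul_left (Cardinal.mk_le_aleph0.trans (Cardinal.cantor ℵ₀).le) _).trans_eq
      (Cardinal.mul_eq_self (Cardinal.cantor ℵ₀).le)
  have coverings_injective : Function.Injective fun J : GrothendieckTopology C =>
      {S : Σ c : C, Sieve c | S.2 ∈ J S.1} := by
    intro J K h
    ext c S
    exact Set.ext_iff.1 h ⟨c, S⟩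
  refine (Cardinal.mk_le_of_injective coverings_injective).trans ?_
  rw [Cardinal.mk_set]
  exact Cardinal.power_le_power_left two_ne_zero mk_sigma_sieve_le

lemma mk_isClosedSubtopos_le_mk_isFinitary (C : Type u) [SmallCategory C] :
    #{J : GrothendieckTopology C // IsClosedSubtopos J} ≤
      #{J : GrothendieckTopology C // IsFinitary J} :=
  Cardinal.mk_subtype_mono fun _ => IsClosedSubtopos.isFinitary

lemma mk_lowerSet_le_mk_isClosedSubtopos (P : Type u) [Preorder P] :
    #(LowerSet P) ≤ #{J : GrothendieckTopology P // IsClosedSubtopos J} :=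
  Cardinal.mk_le_of_injective (f := fun L => ⟨closedTopology (lowerSetPresheaf L),
    isClosedSubtopos_closedTopology_lowerSetPresheaf L⟩) fun _ _ h =>
      closedTopology_lowerSetPresheaf_injective (congr_arg Subtype.val h)

lemma two_power_mk_le_mk_hasEnoughPoints {P : Type u} [Preorder P] [OrderTop P]
    {A : Set (Order.PFilter P)} (hA : IsAntichain (· ≤ ·) A) :
    2 ^ #A ≤ #{J : GrothendieckTopology P // GrothendieckTopology.HasEnoughPoints.{u} J} :=
  two_power_mk_le_of_injOn_powerset (f := fun Y => ⟨_, hasEnoughPoints_filterTopology Y⟩)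
    fun _ hY _ hZ h => filterTopology_injOn_powerset hA hY hZ (congr_arg Subtype.val h)

end Cardinality

section BigCell

open Order

namespace BigCell

instance : SemilatticeInf BigCell where
  inf m n := ⟨PNat.lcm m.val n.val⟩
  inf_le_left m n := PNat.dvd_lcm_left m.val n.val
  inf_le_right m n := PNat.dvd_lcm_right m.val n.val
  le_inf _ _ _ h₁ h₂ := PNat.lcm_dvd h₁ h₂

instance : OrderTop BigCell where
  top := ⟨1⟩
  le_top n := one_dvd n.val

instance : Countable BigCell :=
  Function.Injective.countable (f := BigCell.val) fun _ _ => BigCell.ext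

/-- The exponent of a prime in a positive integer. -/
def exponent (n : BigCell) (q : Nat.Primes) : ℕ := (n.val : ℕ).factorization q

/-- The power of a prime, as an element of the big cell. -/
def primePow (q : Nat.Primes) (k : ℕ) : BigCell := ⟨⟨(q : ℕ) ^ k, pow_pos q.2.pos k⟩⟩

lemma le_iff_exponent_le {m n : BigCell} : m ≤ n ↔ n.exponent ≤ m.exponent := by
  refine PNat.dvd_iff.trans ?_
  rw [← Nat.factorization_prime_le_iff_dvd n.val.ne_zero m.val.ne_zero]
  exact ⟨fun h q => h q q.2, fun h q hq => h ⟨q, hq⟩⟩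

lemma le_primePow_iff {n : BigCell} {q : Nat.Primes} {k : ℕ} :
    n ≤ primePow q k ↔ k ≤ n.exponent q :=
  PNat.dvd_iff.trans (q.2.pow_dvd_iff_le_factorization n.val.ne_zero)

lemma exponent_inf (m n : BigCell) : (m ⊓ n).exponent = m.exponent ⊔ n.exponent := by
  funext q
  change (PNat.lcm m.val n.val : ℕ).factorization q = _
  rw [PNat.lcm_coe, Nat.factorization_lcm m.val.ne_zero n.val.ne_zero, Finsupp.sup_apply]
  rfl

lemma exponent_top : (⊤ : BigCell).exponent = 0 := by
  funext q
  exact congr_arg (· (q : ℕ)) Nat.factorization_one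

lemma finite_support_exponent (n : BigCell) : n.exponent.support.Finite :=
  (n.val : ℕ).factorization.hasFiniteSupport.preimage Nat.Primes.coe_nat_injective.injOn

lemma exponent_primePow (q : Nat.Primes) (k : ℕ) : (primePow q k).exponent = Pi.single q k := by
  funext r
  change ((q : ℕ) ^ k).factorization r = _
  rw [q.2.factorization_pow, Finsupp.single_apply, Pi.single_apply]
  simp only [Nat.Primes.coe_nat_inj, eq_comm]

lemma primePow_one_le_primePow_one_iff {q r : Nat.Primes} :
    primePow q 1 ≤ primePow r 1 ↔ q = r := by
  refine ⟨fun h => ?_, fun h => h ▸ le_rfl⟩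
  by_contra hne
  rw [le_primePow_iff, exponent_primePow, Pi.single_eq_of_ne' hne] at h
  exact one_ne_zero (Nat.le_zero.1 h)

/-- The filter of the positive integers that divide a supernatural number. -/
def divisorPFilter (s : Supernatural) : PFilter BigCell :=
  IsPFilter.toPFilter (F := {n | ∀ q, (n.exponent q : ℕ∞) ≤ s q}) <| .of_def
    ⟨⊤, fun q => by simp [exponent_top]⟩
    (fun m hm n hn => ⟨m ⊓ n, fun q => by
      rw [exponent_inf, Pi.sup_apply, Nat.mono_cast.map_max]
      exact max_le (hm q) (hn q),
      inf_le_left, inf_le_right⟩)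
    fun h hm q => (Nat.cast_le.2 (le_iff_exponent_le.1 h q)).trans (hm q)

lemma mem_divisorPFilter_iff {s : Supernatural} {n : BigCell} :
    n ∈ divisorPFilter s ↔ ∀ q, (n.exponent q : ℕ∞) ≤ s q :=
  Iff.rfl

lemma primePow_mem_divisorPFilter_iff {s : Supernatural} {q : Nat.Primes} {k : ℕ} :
    primePow q k ∈ divisorPFilter s ↔ (k : ℕ∞) ≤ s q := by
  rw [mem_divisorPFilter_iff, exponent_primePow]
  refine ⟨fun h => by simpa using h q, fun h r => ?_⟩
  obtain rfl | hrq := eq_or_ne r q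
  · simpa using h
  · simp [hrq]

lemma mem_pfilter_iff_forall_primePow_mem {F : PFilter BigCell} {n : BigCell} :
    n ∈ F ↔ ∀ q, primePow q (n.exponent q) ∈ F := by
  refine ⟨fun h q => PFilter.mem_of_le (le_primePow_iff.2 le_rfl) h, fun h => ?_⟩
  have hinf : (n.finite_support_exponent.toFinset.inf fun q => primePow q (n.exponent q)) ∈ F :=
    Finset.inf_induction PFilter.top_mem (fun _ hk _ hm => PFilter.inf_mem hk hm) fun q _ => h q
  refine PFilter.mem_of_le (le_iff_exponent_le.2 fun q => ?_) hinf
  by_cases hq : n.exponent q = 0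
  · exact hq ▸ Nat.zero_le _
  · exact le_primePow_iff.1 (Finset.inf_le (n.finite_support_exponent.mem_toFinset.2 hq))

/-- The least common multiple of the members of a filter, as a supernatural number. -/
noncomputable def lcmPFilter (F : PFilter BigCell) : Supernatural :=
  fun q => ⨆ n : F, (n.1.exponent q : ℕ∞)

lemma primePow_mem_iff_le_lcmPFilter {F : PFilter BigCell} {q : Nat.Primes} {k : ℕ} :
    primePow q k ∈ F ↔ (k : ℕ∞) ≤ lcmPFilter F q := by
  constructor
  · intro h
    refine le_trans ?_ (le_iSup (fun n : F => (n.1.exponent q : ℕ∞)) ⟨_, h⟩)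
    rw [exponent_primePow, Pi.single_eq_same]
  · intro h
    suffices ∃ n ∈ F, k ≤ n.exponent q from
      have ⟨n, hn, hk⟩ := this
      PFilter.mem_of_le (le_primePow_iff.2 hk) hn
    obtain _ | k := k
    · exact ⟨⊤, PFilter.top_mem, Nat.zero_le _⟩
    · obtain ⟨n, hn⟩ := lt_iSup_iff.1 ((Nat.cast_lt.2 k.lt_succ_self).trans_le h)
      exact ⟨n, n.2, Nat.cast_lt.1 hn⟩

lemma mem_iff_exponent_le_lcmPFilter {F : PFilter BigCell} {n : BigCell} :
    n ∈ F ↔ ∀ q, (n.exponent q : ℕ∞) ≤ lcmPFilter F q :=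
  mem_pfilter_iff_forall_primePow_mem.trans (forall_congr' fun _ => primePow_mem_iff_le_lcmPFilter)

/-- Filters on the big cell are supernatural numbers: a filter corresponds to the least common
multiple of its members. -/
noncomputable def pfilterOrderIso : PFilter BigCell ≃o Supernatural where
  toFun := lcmPFilter
  invFun := divisorPFilter
  left_inv F := SetLike.ext fun _ => mem_iff_exponent_le_lcmPFilter.symm
  right_inv s := funext fun q => ENat.eq_of_forall_natCast_le_iff fun k => by
    rw [← primePow_mem_iff_le_lcmPFilter, primePow_mem_divisorPFilter_iff]
  map_rel_iff' {F G} := by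
    constructor
    · intro h n hn
      exact mem_iff_exponent_le_lcmPFilter.2
        fun q => (mem_iff_exponent_le_lcmPFilter.1 hn q).trans (h q)
    · intro h q
      exact iSup_le fun n => mem_iff_exponent_le_lcmPFilter.1 (h n.2) q

lemma pfilterOrderIso_principal (n : BigCell) (q : Nat.Primes) :
    pfilterOrderIso (PFilter.principal n) q = n.exponent q := by
  refine ENat.eq_of_forall_natCast_le_iff fun k => ?_
  change (k : ℕ∞) ≤ lcmPFilter _ q ↔ _
  rw [← primePow_mem_iff_le_lcmPFilter, PFilter.mem_principal, le_primePow_iff, Nat.cast_le]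

end BigCell

lemma mk_primes : #Nat.Primes = ℵ₀ := Cardinal.mk_eq_aleph0 _

lemma mk_supernatural : #Supernatural = 2 ^ ℵ₀ := by
  rw [← Cardinal.power_def, mk_primes, Cardinal.mk_eq_aleph0 ℕ∞, Cardinal.power_self_eq le_rfl]

lemma two_power_aleph0_le_mk_lowerSet : 2 ^ ℵ₀ ≤ #(LowerSet BigCell) := by
  let A : Set BigCell := Set.range fun q => BigCell.primePow q 1
  have hA : IsAntichain (· ≤ ·) A := by
    rintro _ ⟨q, rfl⟩ _ ⟨r, rfl⟩ hne h
    exact hne (congr_arg (BigCell.primePow · 1) (BigCell.primePow_one_le_primePow_one_iff.1 h))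
  have mk_A : #A = ℵ₀ := (Cardinal.mk_range_eq _ fun q r h =>
    BigCell.primePow_one_le_primePow_one_iff.1 h.le).trans mk_primes
  exact mk_A ▸ two_power_mk_le_of_injOn_powerset (lowerClosure_injOn_powerset hA)

theorem mk_isClosedSubtopos :
    #{J : GrothendieckTopology BigCell // IsClosedSubtopos J} = 2 ^ ℵ₀ :=
  ((mk_isClosedSubtopos_le_mk_isFinitary _).trans (mk_isFinitary_le _)).antisymm
    (two_power_aleph0_le_mk_lowerSet.trans (mk_lowerSet_le_mk_isClosedSubtopos _))

theorem mk_isCoherentSubtopos :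
    #{J : GrothendieckTopology BigCell // IsCoherentSubtopos J} = 2 ^ ℵ₀ := by
  simp only [isCoherentSubtopos_iff_isFinitary]
  exact (mk_isFinitary_le _).antisymm
    (mk_isClosedSubtopos.symm.trans_le (mk_isClosedSubtopos_le_mk_isFinitary _))

theorem two_power_two_power_aleph0_le_mk_hasEnoughPoints :
    2 ^ ((2 : Cardinal.{0}) ^ ℵ₀) ≤
      #{J : GrothendieckTopology BigCell // GrothendieckTopology.HasEnoughPoints.{0} J} := by
  obtain ⟨φ, hφ, hA⟩ :=
    exists_injective_isAntichain_range (ι := Nat.Primes) (not_le_of_gt (zero_lt_one' ℕ∞))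
  have mk_A : #(BigCell.pfilterOrderIso.symm '' Set.range φ) = 2 ^ ℵ₀ := by
    rw [Cardinal.mk_image_eq BigCell.pfilterOrderIso.symm.injective, Cardinal.mk_range_eq _ hφ,
      Cardinal.mk_set, mk_primes]
  exact mk_A ▸ two_power_mk_le_mk_hasEnoughPoints (hA.image_iso BigCell.pfilterOrderIso.symm)

end BigCell

theorem mainTheorem9 :
    (∃ e : Order.PFilter BigCell ≃o Supernatural, ∀ (n : BigCell) (q : Nat.Primes),
      e (Order.PFilter.principal n) q = (padicValNat (q : ℕ) (n.val : ℕ) : ℕ∞)) ∧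
    #(Order.PFilter BigCell) = 2 ^ ℵ₀ ∧
    #{J : GrothendieckTopology BigCell // IsClosedSubtopos J} = 2 ^ ℵ₀ ∧
    #{J : GrothendieckTopology BigCell // IsCoherentSubtopos J} = 2 ^ ℵ₀ ∧
    #{J : GrothendieckTopology BigCell //
        GrothendieckTopology.HasEnoughPoints.{0} J} = 2 ^ ((2 : Cardinal.{0}) ^ ℵ₀) ∧
    #(GrothendieckTopology BigCell) = 2 ^ ((2 : Cardinal.{0}) ^ ℵ₀) := by
  refine ⟨⟨BigCell.pfilterOrderIso, fun n q => ?_⟩,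
    (Cardinal.mk_congr BigCell.pfilterOrderIso.toEquiv).trans mk_supernatural,
    mk_isClosedSubtopos, mk_isCoherentSubtopos, ?_, ?_⟩
  · rw [BigCell.pfilterOrderIso_principal, BigCell.exponent, Nat.factorization_def _ q.2]
  · exact ((Cardinal.mk_subtype_le _).trans (mk_grothendieckTopology_le _)).antisymm
      two_power_two_power_aleph0_le_mk_hasEnoughPoints
  · exact (mk_grothendieckTopology_le _).antisymm
      (two_power_two_power_aleph0_le_mk_hasEnoughPoints.trans (Cardinal.mk_subtype_le _))
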